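/- Let $T$ be an alphabet (a set, not necessarily finite). For languages $L_1, L_2 \subseteq T^*$ let $(L_1 \leftarrow L_2) = \{xyz : xz \in L_1,\ y \in L_2\}$, let $(L_1 \leftarrow^0 L_2) = L_1$ and $(L_1 \leftarrow^{i} L_2) = ((L_1 \leftarrow^{i-1} L_2) \leftarrow L_2)$ for $i > 0$, and let the iterated insertion be $(L_1 \leftarrow^* L_2) = \bigcup_{i \ge 0} (L_1 \leftarrow^i L_2)$. An indexed grammar over $T$ consists of a finite set $N$ of nonterminals, a finite set $I$ of indices, a start symbol $S \in N$ and a finite set of productions, each of one of the forms $$A[\sigma] \to \alpha[\sigma], \qquad A[\sigma] \to B[\gamma\sigma], \qquad A[\gamma\sigma] \to \alpha[\sigma],$$ with $A, B \in N$, $\gamma \in I$, $\alpha \in (N \cup T)^*$. A linear indexed grammar is defined in the same way, but with productions of the forms $$A[\sigma] \to \alpha[\,]\,B[\sigma]\,\beta[\,], \quad A[\sigma] \to \alpha[\,]\,B[\gamma\sigma]\,\beta[\,], \quad A[\gamma\sigma] \to \alpha[\,]\,B[\sigma]\,\beta[\,], \quad A[\,] \to w,$$ with $A, B \in N$, $\gamma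 \in I$, $\alpha, \beta \in (N \cup T)^*$, $w \in T^*$. Here each production that contains $\sigma$ stands for the family of rewriting rules obtained by letting $\sigma$ range over $I^*$, and $\alpha[\sigma]$ means that every nonterminal of $\alpha$ receives the stack $\sigma$ (terminals carry no stack). The language generated by a grammar is the set of words in $T^*$ that can be derived from $S[\,]$. A language is called (linear) indexed if it is generated by a (linear) indexed grammar. **Theorem.** Let $L_1, L_2 \subseteq T^*$. If $L_1$ and $L_2$ are indexed languages, then $(L_1 \leftarrow^* L_2)$ is an indexed language. If $L_1$ and $L_2$ are linear indexed languages, then $(L_1 \leftarrow^* L_2)$ is a linear indexed language. -/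

import Mathlib

/-! ### Insertion of languages -/

/-- The insertion `L₁ ← L₂ = {xyz : xz ∈ L₁, y ∈ L₂}`. -/
def Language.insertion {T : Type*} (L₁ L₂ : Language T) : Language T :=
  {w | ∃ x y z : List T, w = x ++ y ++ z ∧ x ++ z ∈ L₁ ∧ y ∈ L₂}

/-- The `i`-fold insertion: `L₁ ←⁰ L₂ = L₁` and `L₁ ←ⁱ⁺¹ L₂ = (L₁ ←ⁱ L₂) ← L₂`. -/
def Language.insertionPow {T : Type*} (L₁ L₂ : Language T) : ℕ → Language T
  | 0 => L₁
  | i + 1 => (Language.insertionPow L₁ L₂ i).insertion L₂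

/-- The iterated insertion `L₁ ←* L₂`, the union over all `i ≥ 0` of `L₁ ←ⁱ L₂`. -/
def Language.iteratedInsertion {T : Type*} (L₁ L₂ : Language T) : Language T :=
  {w | ∃ i : ℕ, w ∈ Language.insertionPow L₁ L₂ i}

/-! ### Sentential forms

A sentential form is a word whose letters are terminals and pairs `A[σ]` of a nonterminal `A` and a
stack `σ : List I`; the top of the stack is the head of the list. -/

/-- The sentential form `α[σ]`: every nonterminal of `α` receives the stack `σ`. -/
def withStack {T N I : Type*} (α : List (Symbol T N)) (σ : List I) :
    List (Symbol T (N × List I)) :=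
  α.map fun
    | .terminal a => .terminal a
    | .nonterminal A => .nonterminal (A, σ)

/-! ### Indexed grammars -/

/-- The three forms of productions of an indexed grammar. -/
inductive IndexedRule (T N I : Type*) where
  /-- `A[σ] → α[σ]` -/
  | copy (A : N) (α : List (Symbol T N))
  /-- `A[σ] → B[γσ]` -/
  | push (A B : N) (γ : I)
  /-- `A[γσ] → α[σ]` -/
  | pop (A : N) (γ : I) (α : List (Symbol T N))

/-- `r.Yields A τ u`: the nonterminal `A` with stack `τ` is the left-hand side, and `u` the
right-hand side, of a member of the family of rewriting rules (one for each `σ`) denoted by `r`. -/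
inductive IndexedRule.Yields {T N I : Type*} :
    IndexedRule T N I → N → List I → List (Symbol T (N × List I)) → Prop
  | copy (A : N) (α : List (Symbol T N)) (σ : List I) :
      Yields (.copy A α) A σ (withStack α σ)
  | push (A B : N) (γ : I) (σ : List I) :
      Yields (.push A B γ) A σ [.nonterminal (B, γ :: σ)]
  | pop (A : N) (γ : I) (α : List (Symbol T N)) (σ : List I) :
      Yields (.pop A γ α) A (γ :: σ) (withStack α σ)

/-- An indexed grammar with terminals in `T`. -/
structure IndexedGrammar (T : Type*) where
  /-- The nonterminals. -/
  NT : Type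
  /-- The indices (stack symbols). -/
  Index : Type
  finite_NT : Finite NT
  finite_Index : Finite Index
  /-- The productions. -/
  rules : Set (IndexedRule T NT Index)
  finite_rules : rules.Finite
  /-- The start symbol. -/
  start : NT

/-- One derivation step: one occurrence of a nonterminal with its stack is rewritten. -/
def IndexedGrammar.Produces {T : Type*} (g : IndexedGrammar T)
    (u v : List (Symbol T (g.NT × List g.Index))) : Prop :=
  ∃ r ∈ g.rules, ∃ (A : g.NT) (τ : List g.Index) (m p q : List (Symbol T (g.NT × List g.Index))),
    r.Yields A τ m ∧ u = p ++ [.nonterminal (A, τ)] ++ q ∧ v = p ++ m ++ q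

/-- The language generated by an indexed grammar: the terminal words derivable from the start
symbol with empty stack. -/
def IndexedGrammar.language {T : Type*} (g : IndexedGrammar T) : Language T :=
  {w | Relation.ReflTransGen g.Produces [.nonterminal (g.start, [])] (w.map .terminal)}

/-- A language is indexed if it is generated by an indexed grammar. -/
def Language.IsIndexed {T : Type*} (L : Language T) : Prop :=
  ∃ g : IndexedGrammar T, g.language = L

/-! ### Linear indexed grammars -/

/-- The four forms of productions of a linear indexed grammar. -/
inductive LinearIndexedRule (T N I : Type*) where
  /-- `A[σ] → α[] B[σ] β[]` -/
  | keep (A : N) (α : List (Symbol T N)) (B : N) (β : List (Symbol T N))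
  /-- `A[σ] → α[] B[γσ] β[]` -/
  | push (A : N) (α : List (Symbol T N)) (B : N) (γ : I) (β : List (Symbol T N))
  /-- `A[γσ] → α[] B[σ] β[]` -/
  | pop (A : N) (γ : I) (α : List (Symbol T N)) (B : N) (β : List (Symbol T N))
  /-- `A[] → w` -/
  | halt (A : N) (w : List T)

/-- `r.Yields A τ u`: the nonterminal `A` with stack `τ` is the left-hand side, and `u` the
right-hand side, of a member of the family of rewriting rules (one for each `σ`) denoted by `r`. -/
inductive LinearIndexedRule.Yields {T N I : Type*} :
    LinearIndexedRule T N I → N → List I → List (Symbol T (N × List I)) → Prop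
  | keep (A : N) (α : List (Symbol T N)) (B : N) (β : List (Symbol T N)) (σ : List I) :
      Yields (.keep A α B β) A σ
        (withStack α [] ++ [.nonterminal (B, σ)] ++ withStack β [])
  | push (A : N) (α : List (Symbol T N)) (B : N) (γ : I) (β : List (Symbol T N)) (σ : List I) :
      Yields (.push A α B γ β) A σ
        (withStack α [] ++ [.nonterminal (B, γ :: σ)] ++ withStack β [])
  | pop (A : N) (γ : I) (α : List (Symbol T N)) (B : N) (β : List (Symbol T N)) (σ : List I) :
      Yields (.pop A γ α B β) A (γ :: σ)
        (withStack α [] ++ [.nonterminal (B, σ)] ++ withStack β [])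
  | halt (A : N) (w : List T) :
      Yields (.halt A w) A [] (w.map .terminal)

/-- A linear indexed grammar with terminals in `T`. -/
structure LinearIndexedGrammar (T : Type*) where
  /-- The nonterminals. -/
  NT : Type
  /-- The indices (stack symbols). -/
  Index : Type
  finite_NT : Finite NT
  finite_Index : Finite Index
  /-- The productions. -/
  rules : Set (LinearIndexedRule T NT Index)
  finite_rules : rules.Finite
  /-- The start symbol. -/
  start : NT

/-- One derivation step: one occurrence of a nonterminal with its stack is rewritten. -/
def LinearIndexedGrammar.Produces {T : Type*} (g : LinearIndexedGrammar T)
    (u v : List (Symbol T (g.NT × List g.Index))) : Prop :=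
  ∃ r ∈ g.rules, ∃ (A : g.NT) (τ : List g.Index) (m p q : List (Symbol T (g.NT × List g.Index))),
    r.Yields A τ m ∧ u = p ++ [.nonterminal (A, τ)] ++ q ∧ v = p ++ m ++ q

/-- The language generated by a linear indexed grammar: the terminal words derivable from the start
symbol with empty stack. -/
def LinearIndexedGrammar.language {T : Type*} (g : LinearIndexedGrammar T) : Language T :=
  {w | Relation.ReflTransGen g.Produces [.nonterminal (g.start, [])] (w.map .terminal)}

/-- A language is linear indexed if it is generated by a linear indexed grammar. -/
def Language.IsLinearIndexed {T : Type*} (L : Language T) : Prop :=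
  ∃ g : LinearIndexedGrammar T, g.language = L

/-! Iterated insertion has a recursive description: its results are the words of `L₁` with blocks
inserted, each block being a word of `L₂` that has itself been padded in this way (`Pad`,
`Language.mem_iteratedInsertion_iff`). A block can be charged to the next letter of its host word,
or to the end of the host (`Pad.toLPad`). So it suffices to put a nonterminal `pad` before every
terminal of both given grammars and one after each complete word, and to let `pad` produce sequences
of padded words of `L₂`.

The difficulty lies in the stacks. In an indexed grammar `pad` inherits the stack of its host, which
an inserted derivation could pop; a fresh marker pushed before each insertion prevents this. In a
linear indexed grammar `pad` starts with the empty stack, but `A[] → w` has no room for it. That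
production is replaced by one that passes the stack to `halt`, which vanishes only when the stack is
empty.

Both kinds of grammar are context-free rewriting over the possibly infinite set of pairs `(A, σ)`,
so the core is shared: `Gen.decorate` derives all padded words, while `Gen.toMatches` and
`Matches.undecorate`, applied to the invariant `insertionSem`, exclude all others. -/

/-! ### Iterated insertion as padding -/

/-- `Pad L v w`: the word `w` arises from `v` by iterated insertion of words of `L`. -/
inductive Pad {T : Type*} (L : Language T) : List T → List T → Prop
  | nil : Pad L [] []
  | cons (a : T) {v w : List T} : Pad L v w → Pad L (a :: v) (a :: w)
  | ins {y v w₁ w₂ : List T} : y ∈ L → Pad L y w₁ → Pad L v w₂ → Pad L v (w₁ ++ w₂)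

/-- `LPad P v w`: the word `w` arises from `v` by inserting a word satisfying `P` before each
letter. -/
inductive LPad {T : Type*} (P : List T → Prop) : List T → List T → Prop
  | nil : LPad P [] []
  | cons (a : T) {d v w : List T} : P d → LPad P v w → LPad P (a :: v) (d ++ a :: w)

namespace Pad

variable {T : Type*} {L : Language T}

theorem refl (v : List T) : Pad L v v := by
  induction v with
  | nil => exact .nil
  | cons a v ih => exact .cons a ih

theorem append {v₁ w₁ v₂ w₂ : List T} (h₁ : Pad L v₁ w₁) (h₂ : Pad L v₂ w₂) :
    Pad L (v₁ ++ v₂) (w₁ ++ w₂) := by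
  induction h₁ with
  | nil => exact h₂
  | cons a _ ih => exact .cons a ih
  | ins hy h _ _ ih =>
    rw [List.append_assoc]
    exact .ins hy h ih

/-- The new word falls either between letters of the host or inside (or at the edge of) an existing
block, and the recursive form of `Pad` absorbs both cases. -/
theorem insert {v w x y z : List T} (h : Pad L v w) (hw : w = x ++ z) (hy : y ∈ L) :
    Pad L v (x ++ y ++ z) := by
  induction h generalizing x z with
  | nil =>
    obtain ⟨rfl, rfl⟩ := List.append_eq_nil_iff.1 hw.symm
    exact .ins hy (refl y) .nil
  | cons a h ih =>
    cases x with
    | nil =>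
      obtain rfl : _ = z := hw
      exact .ins hy (refl y) (.cons a h)
    | cons b x =>
      obtain ⟨rfl, rfl⟩ := List.cons.inj hw
      exact .cons _ (ih rfl)
  | ins hy' h₁ h₂ ih₁ ih₂ =>
    rcases List.append_eq_append_iff.1 hw with ⟨t, rfl, rfl⟩ | ⟨t, rfl, rfl⟩
    · simpa using Pad.ins hy' h₁ (ih₂ rfl)
    · simpa using Pad.ins hy' (ih₁ rfl) h₂

end Pad

namespace Language

variable {T : Type*}

theorem iteratedInsertion_step {L₁ L₂ : Language T} {x y z : List T}
    (h : x ++ z ∈ L₁.iteratedInsertion L₂) (hy : y ∈ L₂) :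
    x ++ y ++ z ∈ L₁.iteratedInsertion L₂ := by
  obtain ⟨i, hi⟩ := h
  exact ⟨i + 1, x, y, z, rfl, hi, hy⟩

theorem iteratedInsertion_of_pad {L₁ L₂ : Language T} {v w : List T} (h : Pad L₂ v w) :
    ∀ x z : List T, x ++ v ++ z ∈ L₁.iteratedInsertion L₂ →
      x ++ w ++ z ∈ L₁.iteratedInsertion L₂ := by
  induction h with
  | nil => exact fun _ _ h => h
  | cons a _ ih =>
    intro x z h
    simpa using ih (x ++ [a]) z (by simpa using h)
  | @ins y v w₁ w₂ hy _ _ ih₁ ih₂ =>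
    intro x z h
    -- The host is padded first, then the bare `y` is inserted in front, and finally `y` is padded
    -- in place; this is why the context must vary.
    have h₂ := ih₂ x z h
    rw [List.append_assoc] at h₂
    simpa using ih₁ x (w₂ ++ z) (iteratedInsertion_step h₂ hy)

theorem mem_iteratedInsertion_iff {L₁ L₂ : Language T} {w : List T} :
    w ∈ L₁.iteratedInsertion L₂ ↔ ∃ v ∈ L₁, Pad L₂ v w := by
  constructor
  · rintro ⟨i, hi⟩
    induction i generalizing w with
    | zero => exact ⟨w, hi, .refl w⟩
    | succ i ih =>
      obtain ⟨x, y, z, rfl, h, hy⟩ := hi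
      obtain ⟨v, hv, hp⟩ := ih h
      exact ⟨v, hv, hp.insert rfl hy⟩
  · rintro ⟨v, hv, hp⟩
    simpa using iteratedInsertion_of_pad (L₁ := L₁) hp [] [] (by simpa using ⟨0, hv⟩)

end Language

/-! ### Padding attached to letters -/

namespace LPad

variable {T : Type*} {P : List T → Prop}

theorem append {v₁ w₁ v₂ w₂ : List T} (h₁ : LPad P v₁ w₁) (h₂ : LPad P v₂ w₂) :
    LPad P (v₁ ++ v₂) (w₁ ++ w₂) := by
  induction h₁ with
  | nil => exact h₂
  | cons a hd _ ih => simpa using LPad.cons a hd ih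

/-- Padding belongs to the letter after it and none follows the last letter, so a cut of the host
word induces a cut of the padded word. -/
theorem split {v₁ v₂ w : List T} (h : LPad P (v₁ ++ v₂) w) :
    ∃ w₁ w₂, w = w₁ ++ w₂ ∧ LPad P v₁ w₁ ∧ LPad P v₂ w₂ := by
  induction v₁ generalizing w with
  | nil => exact ⟨[], w, rfl, .nil, h⟩
  | cons a v₁ ih =>
    cases h with
    | cons _ hd h =>
      obtain ⟨w₁, w₂, rfl, h₁, h₂⟩ := ih h
      exact ⟨_, w₂, by simp, .cons a hd h₁, h₂⟩

theorem toPad {L : Language T} {v w : List T} (h : LPad (Pad L []) v w) : Pad L v w := by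
  induction h with
  | nil => exact .nil
  | cons a hd _ ih => exact hd.append (.cons a ih)

end LPad

/-- `P` is left abstract so that it can be derivability from `pad`. In `hins`, `d` is the trailing
padding of the inserted word and `d'` the padding that comes after it. -/
theorem Pad.toLPad {T : Type*} {L : Language T} {P : List T → Prop} (hnil : P [])
    (hins : ∀ y ∈ L, ∀ w d d', LPad P y w → P d → P d' → P (w ++ d ++ d')) {v w : List T}
    (h : Pad L v w) : ∃ w' d, w = w' ++ d ∧ LPad P v w' ∧ P d := by
  induction h with
  | nil => exact ⟨[], [], rfl, .nil, hnil⟩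
  | cons a _ ih =>
    obtain ⟨w', d, rfl, h, hd⟩ := ih
    exact ⟨a :: w', d, rfl, .cons (d := []) a hnil h, hd⟩
  | ins hy _ _ ih₁ ih₂ =>
    obtain ⟨w₁, d₁, rfl, h₁, hd₁⟩ := ih₁
    obtain ⟨w₂, d₂, rfl, h₂, hd₂⟩ := ih₂
    -- A block at the front joins the padding of the first letter of `v`, or the trailing padding if
    -- `v` is empty.
    cases h₂ with
    | nil => exact ⟨[], _, by simp, .nil, hins _ hy _ _ _ h₁ hd₁ hd₂⟩
    | cons a hd h => exact ⟨_, d₂, by simp, .cons a (hins _ hy _ _ _ h₁ hd₁ hd) h, hd₂⟩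

/-! ### Context-free rewriting over an arbitrary set of nonterminals -/

section Rewriting

variable {T V V' : Type*}

/-- `Matches J u w`: the word `w` is obtained from `u` by replacing every nonterminal `A` by a word
satisfying `J A`. -/
inductive Matches (J : V → List T → Prop) : List (Symbol T V) → List T → Prop
  | nil : Matches J [] []
  | terminal (a : T) {u : List (Symbol T V)} {w : List T} :
      Matches J u w → Matches J (.terminal a :: u) (a :: w)
  | nonterminal {A : V} {u : List (Symbol T V)} {w₁ w₂ : List T} :
      J A w₁ → Matches J u w₂ → Matches J (.nonterminal A :: u) (w₁ ++ w₂)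

/-- `Gen R u w`: the terminal word `w` is derivable from `u` by the context-free rules `R`. -/
inductive Gen (R : V → List (Symbol T V) → Prop) : List (Symbol T V) → List T → Prop
  | nil : Gen R [] []
  | terminal (a : T) {u : List (Symbol T V)} {w : List T} :
      Gen R u w → Gen R (.terminal a :: u) (a :: w)
  | nonterminal {A : V} {m u : List (Symbol T V)} {w₁ w₂ : List T} :
      R A m → Gen R m w₁ → Gen R u w₂ → Gen R (.nonterminal A :: u) (w₁ ++ w₂)

/-- One rewriting step with the context-free rules `R`. -/
def Rewrites (R : V → List (Symbol T V) → Prop) (u v : List (Symbol T V)) : Prop :=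
  ∃ A m p q, R A m ∧ u = p ++ [.nonterminal A] ++ q ∧ v = p ++ m ++ q

theorem Rewrites.context {R : V → List (Symbol T V) → Prop} {u v : List (Symbol T V)}
    (h : Rewrites R u v) (x z : List (Symbol T V)) : Rewrites R (x ++ u ++ z) (x ++ v ++ z) := by
  obtain ⟨A, m, p, q, hR, rfl, rfl⟩ := h
  exact ⟨A, m, x ++ p, q ++ z, hR, by simp, by simp⟩

theorem Rewrites.context_star {R : V → List (Symbol T V) → Prop} {u v : List (Symbol T V)}
    (h : Relation.ReflTransGen (Rewrites R) u v) (x z : List (Symbol T V)) :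
    Relation.ReflTransGen (Rewrites R) (x ++ u ++ z) (x ++ v ++ z) :=
  h.lift (fun u => x ++ u ++ z) fun _ _ h => h.context x z

namespace Gen

variable {R : V → List (Symbol T V) → Prop}

theorem append {u₁ u₂ : List (Symbol T V)} {w₁ w₂ : List T} (h₁ : Gen R u₁ w₁)
    (h₂ : Gen R u₂ w₂) : Gen R (u₁ ++ u₂) (w₁ ++ w₂) := by
  induction h₁ with
  | nil => exact h₂
  | terminal a _ ih => exact .terminal a ih
  | nonterminal hR h _ _ ih =>
    rw [List.append_assoc]
    exact .nonterminal hR h ih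

theorem split {u₁ u₂ : List (Symbol T V)} {w : List T} (h : Gen R (u₁ ++ u₂) w) :
    ∃ w₁ w₂, w = w₁ ++ w₂ ∧ Gen R u₁ w₁ ∧ Gen R u₂ w₂ := by
  induction u₁ generalizing w with
  | nil => exact ⟨[], w, rfl, .nil, h⟩
  | cons s u₁ ih =>
    cases h with
    | terminal a h =>
      obtain ⟨w₁, w₂, rfl, h₁, h₂⟩ := ih h
      exact ⟨_, w₂, rfl, .terminal a h₁, h₂⟩
    | nonterminal hR hm h =>
      obtain ⟨w₁, w₂, rfl, h₁, h₂⟩ := ih h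
      exact ⟨_, w₂, by simp, .nonterminal hR hm h₁, h₂⟩

theorem of_terminals (w : List T) : Gen R (w.map .terminal) w := by
  induction w with
  | nil => exact .nil
  | cons a w ih => exact .terminal a ih

theorem single {A : V} {m : List (Symbol T V)} {w : List T} (hR : R A m) (h : Gen R m w) :
    Gen R [.nonterminal A] w := by
  simpa using Gen.nonterminal hR h .nil

theorem cons_nonterminal {A : V} {u : List (Symbol T V)} {w₁ w₂ : List T}
    (h₁ : Gen R [.nonterminal A] w₁) (h₂ : Gen R u w₂) :
    Gen R (.nonterminal A :: u) (w₁ ++ w₂) :=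
  h₁.append h₂

theorem iff_derives {u : List (Symbol T V)} {w : List T} :
    Gen R u w ↔ Relation.ReflTransGen (Rewrites R) u (w.map .terminal) := by
  constructor
  · intro h
    induction h with
    | nil => exact .refl
    | terminal a _ ih => simpa using Rewrites.context_star ih [.terminal a] []
    | @nonterminal A m u w₁ w₂ hR _ _ ih₁ ih₂ =>
      refine .head ⟨A, m, [], u, hR, rfl, rfl⟩ ?_
      have h₁ := Rewrites.context_star ih₁ [] u
      have h₂ := Rewrites.context_star ih₂ (w₁.map .terminal) []
      simp only [List.nil_append, List.append_nil] at h₁ h₂ ⊢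
      simpa using h₁.trans h₂
  · intro h
    induction h using Relation.ReflTransGen.head_induction_on with
    | refl => exact of_terminals w
    | head h _ ih =>
      obtain ⟨A, m, p, q, hR, rfl, rfl⟩ := h
      obtain ⟨_, w₃, rfl, h, h₃⟩ := ih.split
      obtain ⟨w₁, w₂, rfl, h₁, h₂⟩ := h.split
      exact (h₁.append (single hR h₂)).append h₃

/-- An interpretation of the nonterminals that is closed under the rules contains all derivable
words. -/
theorem toMatches {J : V → List T → Prop} (hJ : ∀ A m w, R A m → Matches J m w → J A w)
    {u : List (Symbol T V)} {w : List T} (h : Gen R u w) : Matches J u w := by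
  induction h with
  | nil => exact .nil
  | terminal a _ ih => exact .terminal a ih
  | nonterminal hR _ _ ih₁ ih₂ => exact .nonterminal (hJ _ _ _ hR ih₁) ih₂

end Gen

theorem Matches.single {J : V → List T → Prop} {A : V} {w : List T}
    (h : Matches J [.nonterminal A] w) : J A w := by
  cases h with
  | nonterminal hA h =>
    cases h
    simpa using hA

theorem Matches.pair {J : V → List T → Prop} {A B : V} {w : List T}
    (h : Matches J [.nonterminal A, .nonterminal B] w) :
    ∃ w₁ w₂, w = w₁ ++ w₂ ∧ J A w₁ ∧ J B w₂ := by
  cases h with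
  | nonterminal hA h => exact ⟨_, _, rfl, hA, h.single⟩

theorem Matches.split {J : V → List T → Prop} {u₁ u₂ : List (Symbol T V)} {w : List T}
    (h : Matches J (u₁ ++ u₂) w) :
    ∃ w₁ w₂, w = w₁ ++ w₂ ∧ Matches J u₁ w₁ ∧ Matches J u₂ w₂ := by
  induction u₁ generalizing w with
  | nil => exact ⟨[], w, rfl, .nil, h⟩
  | cons s u₁ ih =>
    cases h with
    | terminal a h =>
      obtain ⟨w₁, w₂, rfl, h₁, h₂⟩ := ih h
      exact ⟨_, w₂, rfl, .terminal a h₁, h₂⟩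
    | nonterminal hA h =>
      obtain ⟨w₁, w₂, rfl, h₁, h₂⟩ := ih h
      exact ⟨_, w₂, by simp, .nonterminal hA h₁, h₂⟩

/-! ### Derivations with decorated right-hand sides -/

/-- `Dec φ D u u'`: the sentential form `u'` arises from `u` by renaming the nonterminals
according to `φ` and putting a nonterminal in `D` before every terminal. -/
inductive Dec (φ : V → V') (D : Set V') : List (Symbol T V) → List (Symbol T V') → Prop
  | nil : Dec φ D [] []
  | terminal (a : T) {d : V'} {u : List (Symbol T V)} {u' : List (Symbol T V')} :
      d ∈ D → Dec φ D u u' → Dec φ D (.terminal a :: u) (.nonterminal d :: .terminal a :: u')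
  | nonterminal (A : V) {u : List (Symbol T V)} {u' : List (Symbol T V')} :
      Dec φ D u u' → Dec φ D (.nonterminal A :: u) (.nonterminal (φ A) :: u')

theorem Dec.append {φ : V → V'} {D : Set V'} {u₁ u₂ : List (Symbol T V)}
    {u₁' u₂' : List (Symbol T V')} (h₁ : Dec φ D u₁ u₁') (h₂ : Dec φ D u₂ u₂') :
    Dec φ D (u₁ ++ u₂) (u₁' ++ u₂') := by
  induction h₁ with
  | nil => exact h₂
  | terminal a hd _ ih => exact .terminal a hd ih
  | nonterminal A _ ih => exact .nonterminal A ih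

/-- The derivation tree is copied rule by rule, with the padding distributed over the subtrees by
`LPad.split`. `hR` asks for derivability rather than a rule `φ A → m'`, which leaves room for the
extra `halt` of the linear case. -/
theorem Gen.decorate {R : V → List (Symbol T V) → Prop} {R' : V' → List (Symbol T V') → Prop}
    {φ : V → V'} {D : Set V'} {P : List T → Prop}
    (hR : ∀ A m, R A m → ∃ m', Dec φ D m m' ∧
      ∀ w, Gen R' m' w → Gen R' [.nonterminal (φ A)] w)
    (hD : ∀ d ∈ D, ∀ w, P w → Gen R' [.nonterminal d] w)
    {u : List (Symbol T V)} {v : List T} (h : Gen R u v) :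
    ∀ {w : List T} {u' : List (Symbol T V')}, LPad P v w → Dec φ D u u' → Gen R' u' w := by
  induction h with
  | nil =>
    rintro _ _ ⟨⟩ ⟨⟩
    exact .nil
  | terminal a _ ih =>
    intro w u' hw hu
    cases hw with
    | cons _ hd hw =>
      cases hu with
      | terminal _ hd' hu => exact (hD _ hd' _ hd).cons_nonterminal (.terminal a (ih hw hu))
  | nonterminal hA _ _ ih₁ ih₂ =>
    intro w u' hw hu
    cases hu with
    | nonterminal _ hu =>
      obtain ⟨w₁, w₂, rfl, h₁, h₂⟩ := hw.split
      obtain ⟨m', hm, hm'⟩ := hR _ _ hA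
      exact (hm' _ (ih₁ h₁ hm)).cons_nonterminal (ih₂ h₂ hu)

/-- Deleting what the decorating nonterminals produce recovers a derivation in the original grammar.
-/
theorem Matches.undecorate {R : V → List (Symbol T V) → Prop} {J : V' → List T → Prop}
    {φ : V → V'} {D : Set V'} {P : List T → Prop}
    (hφ : ∀ A w, J (φ A) w → ∃ v, Gen R [.nonterminal A] v ∧ LPad P v w)
    (hD : ∀ d ∈ D, ∀ w, J d w → P w)
    {u : List (Symbol T V)} {u' : List (Symbol T V')} (hu : Dec φ D u u') :
    ∀ {w : List T}, Matches J u' w → ∃ v, Gen R u v ∧ LPad P v w := by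
  induction hu with
  | nil =>
    rintro _ ⟨⟩
    exact ⟨[], .nil, .nil⟩
  | terminal a hd _ ih =>
    intro w h
    cases h with
    | nonterminal hJ h =>
      cases h with
      | terminal _ h =>
        obtain ⟨v, hv, hp⟩ := ih h
        exact ⟨a :: v, .terminal a hv, .cons a (hD _ hd _ hJ) hp⟩
  | nonterminal A _ ih =>
    intro w h
    cases h with
    | nonterminal hJ h =>
      obtain ⟨v, hv, hp⟩ := ih h
      obtain ⟨v₁, hv₁, hp₁⟩ := hφ _ _ hJ
      exact ⟨v₁ ++ v, hv₁.cons_nonterminal hv, hp₁.append hp⟩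

end Rewriting

/-! ### Decorated right-hand sides -/

section Decorate

variable {T N N' I I' : Type*}

/-- Rename the nonterminals by `f` and put the nonterminal `D` before every terminal. -/
def decorate (D : N') (f : N → N') (α : List (Symbol T N)) : List (Symbol T N') :=
  α.flatMap fun
    | .terminal a => [.nonterminal D, .terminal a]
    | .nonterminal A => [.nonterminal (f A)]

theorem dec_withStack (D : N') (f : N → N') {φ : N × List I → N' × List I'}
    {Ds : Set (N' × List I')} {σ : List I} {τ : List I'} (hφ : ∀ A, φ (A, σ) = (f A, τ))
    (hD : (D, τ) ∈ Ds) (α : List (Symbol T N)) :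
    Dec φ Ds (withStack α σ) (withStack (decorate D f α) τ) := by
  induction α with
  | nil => exact .nil
  | cons s α ih =>
    cases s with
    | terminal a => exact .terminal a hD ih
    | nonterminal A =>
      have := Dec.nonterminal (T := T) (A, σ) ih
      rw [hφ] at this
      exact this

end Decorate

/-- The auxiliary nonterminals of the grammars for iterated insertion. -/
inductive InsertionAux
  /-- the start symbol -/
  | outer
  /-- generates all words obtained from the empty word by iterated insertion -/
  | pad
  /-- generates an inserted word, with further insertions -/
  | item
  /-- like `item`, above the marker at the bottom of the stack -/
  | marked
  /-- generates the empty word from the empty stack -/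
  | halt

theorem InsertionAux.finite : Finite InsertionAux := by
  refine Set.finite_univ_iff.1 (Set.Finite.subset
    (Set.toFinite ({.outer, .pad, .item, .marked, .halt} : Set InsertionAux)) ?_)
  rintro (_ | _ | _ | _ | _) - <;> simp

/-! ### Indexed grammars -/

/-- The decorated production: nonterminals are renamed by `f`, indices by `g`, and the nonterminal
`D` is put before every terminal. -/
def IndexedRule.decorate {T N N' I I' : Type*} (D : N') (f : N → N') (g : I → I') :
    IndexedRule T N I → IndexedRule T N' I'
  | .copy A α => .copy (f A) (_root_.decorate D f α)
  | .push A B γ => .push (f A) (f B) (g γ)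
  | .pop A γ α => .pop (f A) (g γ) (_root_.decorate D f α)

namespace IndexedRule

variable {T N N' I I' : Type*} {D : N'} {f : N → N'} {g : I → I'}

theorem Yields.decorate {r : IndexedRule T N I} {A : N} {σ : List I}
    {m : List (Symbol T (N × List I))} (h : r.Yields A σ m) (ρ : List I') :
    ∃ m', (r.decorate D f g).Yields (f A) (σ.map g ++ ρ) m' ∧
      Dec (fun v => (f v.1, v.2.map g ++ ρ)) {v | v.1 = D} m m' := by
  cases h with
  | copy A α σ => exact ⟨_, .copy _ _ _, dec_withStack D f (fun _ => rfl) (by rfl) α⟩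
  | push A B γ σ => exact ⟨_, .push _ _ _ _, .nonterminal (B, γ :: σ) .nil⟩
  | pop A γ α σ => exact ⟨_, .pop _ _ _ _, dec_withStack D f (fun _ => rfl) (by rfl) α⟩

/-- The part `ρ` of the stack is out of reach as long as its top is not an image under `g`: no
decorated pop can then consume it. -/
theorem Yields.undecorate (hg : Function.Injective g) {r : IndexedRule T N I} {A' : N'}
    {τ : List I'} {m' : List (Symbol T (N' × List I'))} (h : (r.decorate D f g).Yields A' τ m') :
    ∃ A, A' = f A ∧ ∀ σ ρ, τ = σ.map g ++ ρ → (∀ γ ρ', ρ ≠ g γ :: ρ') →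
      ∃ m, r.Yields A σ m ∧ Dec (fun v => (f v.1, v.2.map g ++ ρ)) {v | v.1 = D} m m' := by
  cases r with
  | copy A α =>
    cases h
    refine ⟨A, rfl, ?_⟩
    rintro σ ρ rfl -
    exact ⟨_, .copy _ _ _, dec_withStack D f (fun _ => rfl) (by rfl) α⟩
  | push A B γ =>
    cases h
    refine ⟨A, rfl, ?_⟩
    rintro σ ρ rfl -
    exact ⟨_, .push _ _ _ _, .nonterminal (B, γ :: σ) .nil⟩
  | pop A γ α =>
    cases h
    refine ⟨A, rfl, ?_⟩
    rintro (_ | ⟨γ', σ⟩) ρ h hρ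
    · exact absurd h.symm (hρ _ _)
    · obtain ⟨hγ, rfl⟩ := List.cons.inj h
      obtain rfl := hg hγ
      exact ⟨_, .pop _ _ _ _, dec_withStack D f (fun _ => rfl) (by rfl) α⟩

end IndexedRule

namespace IndexedGrammar

variable {T : Type*}

/-- The rewriting rules denoted by the productions of a grammar. -/
def Rule (g : IndexedGrammar T) (v : g.NT × List g.Index)
    (m : List (Symbol T (g.NT × List g.Index))) : Prop :=
  ∃ r ∈ g.rules, r.Yields v.1 v.2 m

theorem produces_eq (g : IndexedGrammar T) : g.Produces = Rewrites g.Rule := by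
  ext u v
  constructor
  · rintro ⟨r, hr, A, τ, m, p, q, h, hu, hv⟩
    exact ⟨(A, τ), m, p, q, ⟨r, hr, h⟩, hu, hv⟩
  · rintro ⟨⟨A, τ⟩, m, p, q, ⟨r, hr, h⟩, hu, hv⟩
    exact ⟨r, hr, A, τ, m, p, q, h, hu, hv⟩

theorem mem_language_iff {g : IndexedGrammar T} {w : List T} :
    w ∈ g.language ↔ Gen g.Rule [.nonterminal (g.start, [])] w := by
  rw [Gen.iff_derives, ← produces_eq]
  rfl

/-! ### The indexed grammar for the iterated insertion -/

open InsertionAux Sum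

/-- The productions of the grammar for the iterated insertion that do not come from the two given
grammars. -/
def insertionAuxRules (g₁ g₂ : IndexedGrammar T) :
    Set (IndexedRule T (g₁.NT ⊕ g₂.NT ⊕ InsertionAux) (g₁.Index ⊕ g₂.Index ⊕ Unit)) :=
  {.copy (inr (inr outer)) [.nonterminal (inl g₁.start), .nonterminal (inr (inr pad))],
    .copy (inr (inr pad)) [],
    .copy (inr (inr pad)) [.nonterminal (inr (inr item)), .nonterminal (inr (inr pad))],
    .push (inr (inr item)) (inr (inr marked)) (inr (inr ())),
    .copy (inr (inr marked))
      [.nonterminal (inr (inl g₂.start)), .nonterminal (inr (inr pad))]}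

/-- An indexed grammar for the iterated insertion. Every insertion starts by pushing a marker, so
that the stack below it is not touched. -/
def insertion (g₁ g₂ : IndexedGrammar T) : IndexedGrammar T where
  NT := g₁.NT ⊕ g₂.NT ⊕ InsertionAux
  Index := g₁.Index ⊕ g₂.Index ⊕ Unit
  finite_NT := by
    have := g₁.finite_NT
    have := g₂.finite_NT
    have := InsertionAux.finite
    infer_instance
  finite_Index := by
    have := g₁.finite_Index
    have := g₂.finite_Index
    infer_instance
  rules := IndexedRule.decorate (inr (inr pad)) inl inl '' g₁.rules ∪
    IndexedRule.decorate (inr (inr pad)) (inr ∘ inl) (inr ∘ inl) '' g₂.rules ∪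
    insertionAuxRules g₁ g₂
  finite_rules := by
    refine ((g₁.finite_rules.image _).union (g₂.finite_rules.image _)).union ?_
    simp [insertionAuxRules]
  start := inr (inr outer)

variable (g₁ g₂ : IndexedGrammar T)

/-- The words generated by the nonterminals of the grammar for the iterated insertion. -/
def insertionSem : (insertion g₁ g₂).NT × List (insertion g₁ g₂).Index → List T → Prop
  | (inl A, τ), w => ∀ σ ρ, τ = σ.map inl ++ ρ → (∀ γ ρ', ρ ≠ inl γ :: ρ') →
      ∃ v, Gen g₁.Rule [.nonterminal (A, σ)] v ∧ LPad (Pad g₂.language []) v w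
  | (inr (inl A), τ), w => ∀ σ ρ, τ = σ.map (inr ∘ inl) ++ ρ →
      (∀ γ ρ', ρ ≠ (inr ∘ inl) γ :: ρ') →
      ∃ v, Gen g₂.Rule [.nonterminal (A, σ)] v ∧ LPad (Pad g₂.language []) v w
  | (inr (inr outer), τ), w => τ = [] → ∃ v ∈ g₁.language, Pad g₂.language v w
  | (inr (inr pad), _), w => Pad g₂.language [] w
  | (inr (inr item), _), w => ∃ v ∈ g₂.language, Pad g₂.language v w
  | (inr (inr marked), τ), w => ∀ ρ, τ = inr (inr ()) :: ρ →
      ∃ v ∈ g₂.language, Pad g₂.language v w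
  | (inr (inr halt), _), _ => True

/-- For decorated nonterminals the invariant speaks of every stack `σ` above an unreachable
remainder `ρ`; the rules keep `ρ` fixed. -/
theorem insertionSem_closed (A : (insertion g₁ g₂).NT × List (insertion g₁ g₂).Index)
    (m : List (Symbol T _)) (w : List T) (hR : (insertion g₁ g₂).Rule A m)
    (hm : Matches (insertionSem g₁ g₂) m w) : insertionSem g₁ g₂ A w := by
  obtain ⟨A, τ⟩ := A
  obtain ⟨r, (⟨r, hr, rfl⟩ | ⟨r, hr, rfl⟩) | hr, h⟩ := hR
  · obtain ⟨A, rfl, h⟩ := h.undecorate Sum.inl_injective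
    intro σ ρ hτ hρ
    obtain ⟨m₀, h₀, hd⟩ := h σ ρ hτ hρ
    obtain ⟨v, hv, hp⟩ := hm.undecorate (P := Pad g₂.language []) (R := g₁.Rule)
      (fun A w h => h _ _ rfl hρ) (by rintro ⟨_, _⟩ rfl w h; exact h) hd
    exact ⟨v, .single ⟨r, hr, h₀⟩ hv, hp⟩
  · obtain ⟨A, rfl, h⟩ := h.undecorate (Sum.inr_injective.comp Sum.inl_injective)
    intro σ ρ hτ hρ
    obtain ⟨m₀, h₀, hd⟩ := h σ ρ hτ hρ
    obtain ⟨v, hv, hp⟩ := hm.undecorate (P := Pad g₂.language []) (R := g₂.Rule)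
      (fun A w h => h _ _ rfl hρ) (by rintro ⟨_, _⟩ rfl w h; exact h) hd
    exact ⟨v, .single ⟨r, hr, h₀⟩ hv, hp⟩
  · rcases hr with rfl | rfl | rfl | rfl | rfl <;> cases h
    · rintro rfl
      obtain ⟨w₁, w₂, rfl, h₁, h₂⟩ := hm.pair
      obtain ⟨v, hv, hp⟩ := h₁ [] [] rfl (fun _ _ h => nomatch h)
      exact ⟨v, mem_language_iff.2 hv, by simpa using hp.toPad.append h₂⟩
    · cases hm
      exact Pad.nil
    · obtain ⟨w₁, w₂, rfl, ⟨v, hv, hp⟩, h₂⟩ := hm.pair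
      exact Pad.ins hv hp h₂
    · exact hm.single _ rfl
    · rintro ρ rfl
      obtain ⟨w₁, w₂, rfl, h₁, h₂⟩ := hm.pair
      -- The whole stack is the remainder: its top is the marker, which is no index of `g₂`, so `g₂`
      -- starts as if on the empty stack.
      obtain ⟨v, hv, hp⟩ := h₁ [] _ rfl (fun _ _ h => nomatch h)
      exact ⟨v, mem_language_iff.2 hv, by simpa using hp.toPad.append h₂⟩

variable {g₁ g₂} in
theorem insertion_gen_fst {P : List T → Prop}
    (hP : ∀ w, P w → ∀ τ, Gen (insertion g₁ g₂).Rule [.nonterminal (inr (inr pad), τ)] w)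
    {v w : List T} (hv : v ∈ g₁.language) (hp : LPad P v w)
    (ρ : List (insertion g₁ g₂).Index) :
    Gen (insertion g₁ g₂).Rule [.nonterminal (inl g₁.start, ρ)] w := by
  refine Gen.decorate (φ := fun v => (inl v.1, v.2.map inl ++ ρ))
    (D := {v | v.1 = inr (inr pad)}) ?_ ?_ (mem_language_iff.1 hv) hp (.nonterminal _ .nil)
  · rintro ⟨A, σ⟩ m ⟨r, hr, h⟩
    obtain ⟨m', h', hd⟩ := h.decorate (D := inr (inr pad)) (f := inl) (g := inl) ρ
    exact ⟨m', hd, fun w => .single ⟨_, Or.inl (Or.inl ⟨r, hr, rfl⟩), h'⟩⟩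
  · rintro ⟨_, τ⟩ rfl w hw
    exact hP w hw τ

variable {g₁ g₂} in
theorem insertion_gen_snd {P : List T → Prop}
    (hP : ∀ w, P w → ∀ τ, Gen (insertion g₁ g₂).Rule [.nonterminal (inr (inr pad), τ)] w)
    {v w : List T} (hv : v ∈ g₂.language) (hp : LPad P v w)
    (ρ : List (insertion g₁ g₂).Index) :
    Gen (insertion g₁ g₂).Rule [.nonterminal (inr (inl g₂.start), ρ)] w := by
  refine Gen.decorate (φ := fun v => (inr (inl v.1), v.2.map (inr ∘ inl) ++ ρ))
    (D := {v | v.1 = inr (inr pad)}) ?_ ?_ (mem_language_iff.1 hv) hp (.nonterminal _ .nil)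
  · rintro ⟨A, σ⟩ m ⟨r, hr, h⟩
    obtain ⟨m', h', hd⟩ := h.decorate (D := inr (inr pad)) (f := inr ∘ inl)
      (g := inr ∘ inl) ρ
    exact ⟨m', hd, fun w => .single ⟨_, Or.inl (Or.inr ⟨r, hr, rfl⟩), h'⟩⟩
  · rintro ⟨_, τ⟩ rfl w hw
    exact hP w hw τ

theorem language_insertion :
    (insertion g₁ g₂).language = g₁.language.iteratedInsertion g₂.language := by
  ext w
  rw [mem_language_iff, Language.mem_iteratedInsertion_iff]
  constructor
  · intro h
    exact (h.toMatches (insertionSem_closed g₁ g₂)).single rfl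
  · rintro ⟨v, hv, hp⟩
    have aux : ∀ r ∈ insertionAuxRules g₁ g₂, r ∈ (insertion g₁ g₂).rules := fun _ hr => Or.inr hr
    simp only [insertionAuxRules, Set.mem_insert_iff, Set.mem_singleton_iff, forall_eq_or_imp,
      forall_eq] at aux
    obtain ⟨hstart, hnil, hpad, hitem, hmarked⟩ := aux
    -- All stacks `τ` are needed, since `pad` inherits whatever stack its host carries.
    obtain ⟨w, d, rfl, hw, hd⟩ := hp.toLPad
      (P := fun w => ∀ τ, Gen (insertion g₁ g₂).Rule [.nonterminal (inr (inr pad), τ)] w)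
      (fun τ => .single ⟨_, hnil, .copy _ _ _⟩ .nil)
      (by
        intro y hy w d d' hw hd hd' τ
        refine .single ⟨_, hpad, .copy _ _ _⟩ (Gen.cons_nonterminal ?_ (hd' τ))
        refine .single ⟨_, hitem, .push _ _ _ _⟩ (.single ⟨_, hmarked, .copy _ _ _⟩ ?_)
        exact Gen.cons_nonterminal (insertion_gen_snd (fun _ h => h) hy hw _) (hd _))
    exact .single ⟨_, hstart, .copy _ _ _⟩
      (Gen.cons_nonterminal (insertion_gen_fst (fun _ h => h) hv hw _) (hd _))

end IndexedGrammar

/-! ### Linear indexed grammars -/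

/-- The decorated production: nonterminals are renamed by `f`, indices by `g`, and the nonterminal
`D` is put before every terminal. Since `D` cannot occur in a halting production, such a production
passes the stack to the nonterminal `H`. -/
def LinearIndexedRule.decorate {T N N' I I' : Type*} (D H : N') (f : N → N') (g : I → I') :
    LinearIndexedRule T N I → LinearIndexedRule T N' I'
  | .keep A α B β => .keep (f A) (_root_.decorate D f α) (f B) (_root_.decorate D f β)
  | .push A α B γ β => .push (f A) (_root_.decorate D f α) (f B) (g γ) (_root_.decorate D f β)
  | .pop A γ α B β => .pop (f A) (g γ) (_root_.decorate D f α) (f B) (_root_.decorate D f β)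
  | .halt A w => .keep (f A) (_root_.decorate D f (w.map .terminal)) H []

namespace LinearIndexedRule

variable {T N N' I I' : Type*} {D H : N'} {f : N → N'} {g : I → I'}

theorem withStack_terminals (w : List T) (σ : List I) :
    withStack (w.map .terminal : List (Symbol T N)) σ = w.map .terminal := by
  simp [withStack]

theorem dec_sandwich {φ : N × List I → N' × List I'} (hφ : ∀ v, φ v = (f v.1, v.2.map g))
    (α β : List (Symbol T N)) (B : N) (σ : List I) :
    Dec φ {(D, [])} (withStack α [] ++ [.nonterminal (B, σ)] ++ withStack β [])
      (withStack (_root_.decorate D f α) [] ++ [.nonterminal (f B, σ.map g)] ++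
        withStack (_root_.decorate D f β) []) := by
  obtain rfl : φ = fun v => (f v.1, v.2.map g) := funext hφ
  exact ((dec_withStack D f (fun _ => rfl) (by rfl) α).append (.nonterminal (B, σ) .nil)).append
    (dec_withStack D f (fun _ => rfl) (by rfl) β)

theorem Yields.decorate {r : LinearIndexedRule T N I} {A : N} {σ : List I}
    {m : List (Symbol T (N × List I))} (h : r.Yields A σ m) :
    ∃ m' e, (r.decorate D H f g).Yields (f A) (σ.map g) (m' ++ e) ∧
      (e = [] ∨ e = [.nonterminal (H, [])]) ∧
      Dec (fun v => (f v.1, v.2.map g)) {(D, [])} m m' := by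
  cases h with
  | keep A α B β σ =>
    exact ⟨_, [], by rw [List.append_nil]; exact .keep _ _ _ _ _, Or.inl rfl,
      dec_sandwich (fun _ => rfl) α β B σ⟩
  | push A α B γ β σ =>
    exact ⟨_, [], by rw [List.append_nil]; exact .push _ _ _ _ _ _, Or.inl rfl,
      dec_sandwich (fun _ => rfl) α β B (γ :: σ)⟩
  | pop A γ α B β σ =>
    exact ⟨_, [], by rw [List.append_nil]; exact .pop _ _ _ _ _ _, Or.inl rfl,
      dec_sandwich (fun _ => rfl) α β B σ⟩
  | halt A w =>
    refine ⟨withStack (_root_.decorate D f (w.map .terminal)) [], _, ?_, Or.inr rfl, ?_⟩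
    · simpa [withStack, LinearIndexedRule.decorate] using Yields.keep (T := T) (f A)
        (_root_.decorate D f (w.map .terminal)) H [] ([] : List I')
    · rw [← withStack_terminals w ([] : List I)]
      exact dec_withStack D f (fun _ => rfl) (by rfl) _

/-- The second alternative is a former halting production. It now applies to any stack, so the
original step is recovered only when `σ = []`; the trailing `H` has to enforce this. -/
theorem Yields.undecorate (hg : Function.Injective g) {r : LinearIndexedRule T N I} {A' : N'}
    {τ : List I'} {m' : List (Symbol T (N' × List I'))}
    (h : (r.decorate D H f g).Yields A' τ m') :
    ∃ A, A' = f A ∧ ∀ σ, τ = σ.map g →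
      (∃ m, r.Yields A σ m ∧ Dec (fun v => (f v.1, v.2.map g)) {(D, [])} m m') ∨
      ∃ m m'', m' = m'' ++ [.nonterminal (H, τ)] ∧ (σ = [] → r.Yields A σ m) ∧
        Dec (fun v => (f v.1, v.2.map g)) {(D, [])} m m'' := by
  cases r with
  | keep A α B β =>
    cases h
    refine ⟨A, rfl, ?_⟩
    rintro σ rfl
    exact Or.inl ⟨_, .keep _ _ _ _ _, dec_sandwich (fun _ => rfl) α β B σ⟩
  | push A α B γ β =>
    cases h
    refine ⟨A, rfl, ?_⟩
    rintro σ rfl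
    exact Or.inl ⟨_, .push _ _ _ _ _ _, dec_sandwich (fun _ => rfl) α β B (γ :: σ)⟩
  | pop A γ α B β =>
    cases h
    refine ⟨A, rfl, ?_⟩
    rintro (_ | ⟨γ', σ⟩) h
    · simp at h
    · obtain ⟨hγ, rfl⟩ := List.cons.inj h
      obtain rfl := hg hγ
      exact Or.inl ⟨_, .pop _ _ _ _ _ _, dec_sandwich (fun _ => rfl) α β B σ⟩
  | halt A w =>
    cases h
    refine ⟨A, rfl, ?_⟩
    rintro σ rfl
    refine Or.inr ⟨w.map .terminal, _, List.append_nil _, ?_, ?_⟩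
    · rintro rfl
      exact .halt _ _
    · rw [← withStack_terminals w ([] : List I)]
      exact dec_withStack D f (fun _ => rfl) (by rfl) _

end LinearIndexedRule

namespace LinearIndexedGrammar

variable {T : Type*}

/-- The rewriting rules denoted by the productions of a grammar. -/
def Rule (g : LinearIndexedGrammar T) (v : g.NT × List g.Index)
    (m : List (Symbol T (g.NT × List g.Index))) : Prop :=
  ∃ r ∈ g.rules, r.Yields v.1 v.2 m

theorem produces_eq (g : LinearIndexedGrammar T) : g.Produces = Rewrites g.Rule := by
  ext u v
  constructor
  · rintro ⟨r, hr, A, τ, m, p, q, h, hu, hv⟩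
    exact ⟨(A, τ), m, p, q, ⟨r, hr, h⟩, hu, hv⟩
  · rintro ⟨⟨A, τ⟩, m, p, q, ⟨r, hr, h⟩, hu, hv⟩
    exact ⟨r, hr, A, τ, m, p, q, h, hu, hv⟩

theorem mem_language_iff {g : LinearIndexedGrammar T} {w : List T} :
    w ∈ g.language ↔ Gen g.Rule [.nonterminal (g.start, [])] w := by
  rw [Gen.iff_derives, ← produces_eq]
  rfl

/-! ### The linear indexed grammar for the iterated insertion -/

open InsertionAux Sum

/-- The productions of the grammar for the iterated insertion that do not come from the two given
grammars. -/
def insertionAuxRules (g₁ g₂ : LinearIndexedGrammar T) :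
    Set (LinearIndexedRule T (g₁.NT ⊕ g₂.NT ⊕ InsertionAux) (g₁.Index ⊕ g₂.Index)) :=
  {.keep (inr (inr outer)) [] (inl g₁.start) [.nonterminal (inr (inr pad))],
    .halt (inr (inr pad)) [],
    .keep (inr (inr pad)) [] (inr (inr item)) [.nonterminal (inr (inr pad))],
    .keep (inr (inr item)) [] (inr (inl g₂.start)) [.nonterminal (inr (inr pad))],
    .halt (inr (inr halt)) []}

/-- A linear indexed grammar for the iterated insertion. -/
def insertion (g₁ g₂ : LinearIndexedGrammar T) : LinearIndexedGrammar T where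
  NT := g₁.NT ⊕ g₂.NT ⊕ InsertionAux
  Index := g₁.Index ⊕ g₂.Index
  finite_NT := by
    have := g₁.finite_NT
    have := g₂.finite_NT
    have := InsertionAux.finite
    infer_instance
  finite_Index := by
    have := g₁.finite_Index
    have := g₂.finite_Index
    infer_instance
  rules := LinearIndexedRule.decorate (inr (inr pad)) (inr (inr halt)) inl inl '' g₁.rules ∪
    LinearIndexedRule.decorate (inr (inr pad)) (inr (inr halt)) (inr ∘ inl) inr ''
      g₂.rules ∪
    insertionAuxRules g₁ g₂
  finite_rules := by
    refine ((g₁.finite_rules.image _).union (g₂.finite_rules.image _)).union ?_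
    simp [insertionAuxRules]
  start := inr (inr outer)

variable (g₁ g₂ : LinearIndexedGrammar T)

/-- The words generated by the nonterminals of the grammar for the iterated insertion. -/
def insertionSem : (insertion g₁ g₂).NT × List (insertion g₁ g₂).Index → List T → Prop
  | (inl A, τ), w => ∀ σ, τ = σ.map inl →
      ∃ v, Gen g₁.Rule [.nonterminal (A, σ)] v ∧ LPad (Pad g₂.language []) v w
  | (inr (inl A), τ), w => ∀ σ, τ = σ.map inr →
      ∃ v, Gen g₂.Rule [.nonterminal (A, σ)] v ∧ LPad (Pad g₂.language []) v w
  | (inr (inr outer), τ), w => τ = [] → ∃ v ∈ g₁.language, Pad g₂.language v w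
  | (inr (inr pad), τ), w => τ = [] → Pad g₂.language [] w
  | (inr (inr item), τ), w => τ = [] → ∃ v ∈ g₂.language, Pad g₂.language v w
  | (inr (inr marked), _), _ => True
  | (inr (inr halt), τ), w => τ = [] ∧ w = []

theorem insertionSem_closed (A : (insertion g₁ g₂).NT × List (insertion g₁ g₂).Index)
    (m : List (Symbol T _)) (w : List T) (hR : (insertion g₁ g₂).Rule A m)
    (hm : Matches (insertionSem g₁ g₂) m w) : insertionSem g₁ g₂ A w := by
  obtain ⟨A, τ⟩ := A
  obtain ⟨r, (⟨r, hr, rfl⟩ | ⟨r, hr, rfl⟩) | hr, h⟩ := hR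
  · obtain ⟨A, rfl, h⟩ := h.undecorate Sum.inl_injective
    intro σ hτ
    obtain ⟨m₀, h₀, hd⟩ | ⟨m₀, m₁, rfl, h₀, hd⟩ := h σ hτ
    · obtain ⟨v, hv, hp⟩ := hm.undecorate (P := Pad g₂.language []) (R := g₁.Rule)
        (J := insertionSem g₁ g₂)
        (by exact fun A w h => h _ rfl) (by rintro _ rfl w h; exact h rfl) hd
      exact ⟨v, .single ⟨r, hr, h₀⟩ hv, hp⟩
    · obtain ⟨w₁, w₂, rfl, h₁, h₂⟩ := hm.split
      -- The invariant of `halt` forces the empty stack and contributes the empty word.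
      obtain ⟨rfl, rfl⟩ := h₂.single
      obtain ⟨v, hv, hp⟩ := h₁.undecorate (P := Pad g₂.language []) (R := g₁.Rule)
        (J := insertionSem g₁ g₂)
        (by exact fun A w h => h _ rfl) (by rintro _ rfl w h; exact h rfl) hd
      exact ⟨v, .single ⟨r, hr, h₀ (List.map_eq_nil_iff.1 hτ.symm)⟩ hv, by simpa using hp⟩
  · obtain ⟨A, rfl, h⟩ := h.undecorate Sum.inr_injective
    intro σ hτ
    obtain ⟨m₀, h₀, hd⟩ | ⟨m₀, m₁, rfl, h₀, hd⟩ := h σ hτ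
    · obtain ⟨v, hv, hp⟩ := hm.undecorate (P := Pad g₂.language []) (R := g₂.Rule)
        (J := insertionSem g₁ g₂)
        (by exact fun A w h => h _ rfl) (by rintro _ rfl w h; exact h rfl) hd
      exact ⟨v, .single ⟨r, hr, h₀⟩ hv, hp⟩
    · obtain ⟨w₁, w₂, rfl, h₁, h₂⟩ := hm.split
      obtain ⟨rfl, rfl⟩ := h₂.single
      obtain ⟨v, hv, hp⟩ := h₁.undecorate (P := Pad g₂.language []) (R := g₂.Rule)
        (J := insertionSem g₁ g₂)
        (by exact fun A w h => h _ rfl) (by rintro _ rfl w h; exact h rfl) hd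
      exact ⟨v, .single ⟨r, hr, h₀ (List.map_eq_nil_iff.1 hτ.symm)⟩ hv, by simpa using hp⟩
  · rcases hr with rfl | rfl | rfl | rfl | rfl <;> cases h
    · rintro rfl
      obtain ⟨w₁, w₂, rfl, h₁, h₂⟩ := hm.pair
      obtain ⟨v, hv, hp⟩ := h₁ [] rfl
      exact ⟨v, mem_language_iff.2 hv, by simpa using hp.toPad.append (h₂ rfl)⟩
    · cases hm
      exact fun _ => Pad.nil
    · rintro rfl
      obtain ⟨w₁, w₂, rfl, h₁, h₂⟩ := hm.pair
      obtain ⟨v, hv, hp⟩ := h₁ rfl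
      exact Pad.ins hv hp (h₂ rfl)
    · rintro rfl
      obtain ⟨w₁, w₂, rfl, h₁, h₂⟩ := hm.pair
      obtain ⟨v, hv, hp⟩ := h₁ [] rfl
      exact ⟨v, mem_language_iff.2 hv, by simpa using hp.toPad.append (h₂ rfl)⟩
    · cases hm
      exact ⟨rfl, rfl⟩

variable {g₁ g₂}

theorem insertion_gen_halt
    {m e : List (Symbol T ((insertion g₁ g₂).NT × List (insertion g₁ g₂).Index))} {w : List T}
    (he : e = [] ∨ e = [.nonterminal (inr (inr halt), [])])
    (h : Gen (insertion g₁ g₂).Rule m w) : Gen (insertion g₁ g₂).Rule (m ++ e) w := by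
  obtain rfl | rfl := he
  · simpa using h
  · have hhalt : .halt (inr (inr halt)) [] ∈ (insertion g₁ g₂).rules :=
      Or.inr (.inr (.inr (.inr (.inr rfl))))
    simpa using h.append (Gen.single ⟨_, hhalt, .halt _ _⟩ .nil)

theorem insertion_gen_fst {P : List T → Prop}
    (hP : ∀ w, P w → Gen (insertion g₁ g₂).Rule [.nonterminal (inr (inr pad), [])] w)
    {v w : List T} (hv : v ∈ g₁.language) (hp : LPad P v w) :
    Gen (insertion g₁ g₂).Rule [.nonterminal (inl g₁.start, [])] w := by
  refine Gen.decorate (φ := fun v => (inl v.1, v.2.map inl))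
    (D := {(inr (inr pad), [])}) ?_ ?_ (mem_language_iff.1 hv) hp (.nonterminal _ .nil)
  · rintro ⟨A, σ⟩ m ⟨r, hr, h⟩
    obtain ⟨m', e, h', he, hd⟩ := h.decorate (D := inr (inr pad)) (H := inr (inr halt))
      (f := inl) (g := inl)
    exact ⟨m', hd, fun w hw =>
      .single ⟨_, Or.inl (Or.inl ⟨r, hr, rfl⟩), h'⟩ (insertion_gen_halt he hw)⟩
  · rintro _ rfl w hw
    exact hP w hw

theorem insertion_gen_snd {P : List T → Prop}
    (hP : ∀ w, P w → Gen (insertion g₁ g₂).Rule [.nonterminal (inr (inr pad), [])] w)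
    {v w : List T} (hv : v ∈ g₂.language) (hp : LPad P v w) :
    Gen (insertion g₁ g₂).Rule [.nonterminal (inr (inl g₂.start), [])] w := by
  refine Gen.decorate (φ := fun v => (inr (inl v.1), v.2.map inr))
    (D := {(inr (inr pad), [])}) ?_ ?_ (mem_language_iff.1 hv) hp (.nonterminal _ .nil)
  · rintro ⟨A, σ⟩ m ⟨r, hr, h⟩
    obtain ⟨m', e, h', he, hd⟩ := h.decorate (D := inr (inr pad)) (H := inr (inr halt))
      (f := inr ∘ inl) (g := inr)
    exact ⟨m', hd, fun w hw =>
      .single ⟨_, Or.inl (Or.inr ⟨r, hr, rfl⟩), h'⟩ (insertion_gen_halt he hw)⟩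
  · rintro _ rfl w hw
    exact hP w hw

variable (g₁ g₂)

theorem language_insertion :
    (insertion g₁ g₂).language = g₁.language.iteratedInsertion g₂.language := by
  ext w
  rw [mem_language_iff, Language.mem_iteratedInsertion_iff]
  constructor
  · intro h
    exact (h.toMatches (insertionSem_closed g₁ g₂)).single rfl
  · rintro ⟨v, hv, hp⟩
    have aux : ∀ r ∈ insertionAuxRules g₁ g₂, r ∈ (insertion g₁ g₂).rules := fun _ hr => Or.inr hr
    simp only [insertionAuxRules, Set.mem_insert_iff, Set.mem_singleton_iff, forall_eq_or_imp,
      forall_eq] at aux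
    obtain ⟨hstart, hnil, hpad, hitem, -⟩ := aux
    obtain ⟨w, d, rfl, hw, hd⟩ := hp.toLPad
      (P := fun w => Gen (insertion g₁ g₂).Rule [.nonterminal (inr (inr pad), [])] w)
      (.single ⟨_, hnil, .halt _ _⟩ .nil)
      (by
        intro y hy w d d' hw hd hd'
        -- Everything here runs on the empty stack, so no marker is needed; `d` follows `y` inside
        -- `item`, and `d'` comes from the second `pad`.
        refine .single ⟨_, hpad, .keep _ _ _ _ _⟩ (Gen.cons_nonterminal ?_ hd')
        refine .single ⟨_, hitem, .keep _ _ _ _ _⟩ ?_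
        exact Gen.cons_nonterminal (insertion_gen_snd (fun _ h => h) hy hw) hd)
    exact .single ⟨_, hstart, .keep _ _ _ _ _⟩
      (Gen.cons_nonterminal (insertion_gen_fst (fun _ h => h) hv hw) hd)

end LinearIndexedGrammar

theorem theorem3p6 {T : Type*} :
    (∀ L₁ L₂ : Language T, L₁.IsIndexed → L₂.IsIndexed →
      (L₁.iteratedInsertion L₂).IsIndexed) ∧
    (∀ L₁ L₂ : Language T, L₁.IsLinearIndexed → L₂.IsLinearIndexed →
      (L₁.iteratedInsertion L₂).IsLinearIndexed) := by
  constructor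
  · rintro _ _ ⟨g₁, rfl⟩ ⟨g₂, rfl⟩
    exact ⟨_, IndexedGrammar.language_insertion g₁ g₂⟩
  · rintro _ _ ⟨g₁, rfl⟩ ⟨g₂, rfl⟩
    exact ⟨_, LinearIndexedGrammar.language_insertion g₁ g₂⟩
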